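/- Let $N\ge 2$ be an integer, let $R\in(0,1]$, and let $B_R$ be the open ball of radius $R$ centred at $0$ in $\mathbb{R}^N$. For $\alpha\in\mathbb{R}$ consider $$-\Delta u-\frac{(N-2)^2}{4}|x|^{-2}u\ \ge\ \alpha\,|x|^{-2}\bigl|\log|x|\bigr|^{-2}u\quad\text{in }\mathcal D'(B_R\setminus\{0\}).\qquad(*)$$ A distributional solution of $(*)$ is a function $u\in L^1_{\rm loc}(B_R\setminus\{0\})$ such that, for every non-negative $\varphi\in C_c^\infty(B_R\setminus\{0\})$, $$-\int_{B_R}u\,\Delta\varphi\,dx-\frac{(N-2)^2}{4}\int_{B_R}|x|^{-2}u\varphi\,dx\ \ge\ \alpha\int_{B_R}|x|^{-2}\bigl|\log|x|\bigr|^{-2}u\varphi\,dx.$$ For $\gamma\in\mathbb{R}$ write $u\in L^2_{\rm loc}(B_R;|x|^{-2}|\log|x||^{-2\gamma}dx)$ if $u$ is measurable and $\int_K|x|^{-2}|\log|x||^{-2\gamma}|u|^2\,dx<\infty$ for every compact $K\subset B_R$ (the origin may belong to $K$). (Nonexistence.) Let $\alpha\in\mathbb{R}$ and let $u\ge 0$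 be a distributional solution of $(*)$. If there is $\gamma\le 1$ such that $$u\in L^2_{\rm loc}\bigl(B_R;|x|^{-2}|\log|x||^{-2\gamma}dx\bigr)\quad\text{and}\quad \alpha\ge\tfrac14-(1-\gamma)^2,$$ then $u=0$ almost everywhere in $B_R$. (Sharpness.) Let $\alpha\le\frac14$, put $\delta_\alpha=\frac{\sqrt{1-4\alpha}-1}{2}$ and $u_\alpha(x)=|x|^{\frac{2-N}{2}}\bigl|\log|x|\bigr|^{-\delta_\alpha}$. Then $u_\alpha>0$ in $B_R\setminus\{0\}$, $u_\alpha\in L^1_{\rm loc}(B_R\setminus\{0\})$, and $u_\alpha$ solves $(*)$ in the sense of distributions with equality. Moreover, for every $\gamma\le1$, $$u_\alpha\in L^2_{\rm loc}\bigl(B_R;|x|^{-2}|\log|x||^{-2\gamma}dx\bigr)\iff \alpha<\tfrac14-(1-\gamma)^2.$$ -/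

import Mathlib

open MeasureTheory Metric Set
open scoped ContDiff

noncomputable section

namespace HardyLeray

/-- The space `ℝ^N` with its Euclidean norm and Lebesgue measure. -/
abbrev E (N : ℕ) : Type := EuclideanSpace ℝ (Fin N)

/-- The punctured open ball `B_R \ {0}`. -/
def puncturedBall (N : ℕ) (R : ℝ) : Set (E N) := ball 0 R \ {0}

/-- The test functions `φ ∈ C_c^∞(Ω)`: smooth functions with compact support contained in `Ω`. -/
structure IsTestFunction {N : ℕ} (Ω : Set (E N)) (φ : E N → ℝ) : Prop where
  contDiff : ContDiff ℝ ∞ φ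
  hasCompactSupport : HasCompactSupport φ
  tsupport_subset : tsupport φ ⊆ Ω

/-- The left-hand side of the equation tested against `φ`:
`-∫_Ω u Δφ dx - (N-2)²/4 ∫_Ω |x|⁻² u φ dx`. -/
def hardyPairing {N : ℕ} (Ω : Set (E N)) (u φ : E N → ℝ) : ℝ :=
  -(∫ x in Ω, u x * Laplacian.laplacian φ x)
    - ((N : ℝ) - 2) ^ 2 / 4 * ∫ x in Ω, ‖x‖ ^ (-2 : ℤ) * u x * φ x

/-- The Leray term tested against `φ`: `∫_Ω |x|⁻² |log|x||⁻² u φ dx`. -/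
def lerayPairing {N : ℕ} (Ω : Set (E N)) (u φ : E N → ℝ) : ℝ :=
  ∫ x in Ω, ‖x‖ ^ (-2 : ℤ) * |Real.log ‖x‖| ^ (-2 : ℤ) * u x * φ x

/-- `u ∈ L¹_loc(B_R \ {0})` is a distributional solution of the inequality
`-Δu - (N-2)²/4 |x|⁻² u ≥ α |x|⁻² |log|x||⁻² u` in `B_R \ {0}`. -/
structure IsSupersolution {N : ℕ} (R α : ℝ) (u : E N → ℝ) : Prop where
  locallyIntegrableOn : LocallyIntegrableOn u (puncturedBall N R) volume
  inequality : ∀ φ : E N → ℝ, IsTestFunction (puncturedBall N R) φ → (∀ x, 0 ≤ φ x) →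
    α * lerayPairing (puncturedBall N R) u φ ≤ hardyPairing (puncturedBall N R) u φ

/-- `u ∈ L¹_loc(B_R \ {0})` is a distributional solution of the equation
`-Δu - (N-2)²/4 |x|⁻² u = α |x|⁻² |log|x||⁻² u` in `B_R \ {0}`. -/
structure IsSolution {N : ℕ} (R α : ℝ) (u : E N → ℝ) : Prop where
  locallyIntegrableOn : LocallyIntegrableOn u (puncturedBall N R) volume
  equation : ∀ φ : E N → ℝ, IsTestFunction (puncturedBall N R) φ →
    hardyPairing (puncturedBall N R) u φ = α * lerayPairing (puncturedBall N R) u φ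

/-- `u ∈ L²_loc(B_R; |x|⁻² |log|x||^(-2γ) dx)`: on every compact subset `K` of the open ball `B_R`
(which may contain the origin), `u` is measurable and `∫_K |u|² |x|⁻² |log|x||^(-2γ) dx < ∞`. -/
def MemWeightedL2Loc {N : ℕ} (R γ : ℝ) (u : E N → ℝ) : Prop :=
  ∀ K : Set (E N), IsCompact K → K ⊆ ball 0 R →
    AEStronglyMeasurable u (volume.restrict K) ∧
    IntegrableOn (fun x => |u x| ^ 2 * (‖x‖ ^ (-2 : ℤ) * |Real.log ‖x‖| ^ (-2 * γ))) K volume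

/-- The function `u_α(x) = |x|^((2-N)/2) |log|x||^(-δ)` with `δ = (√(1-4α) - 1)/2`. -/
def explicitSolution (N : ℕ) (α : ℝ) (x : E N) : ℝ :=
  ‖x‖ ^ ((2 - (N : ℝ)) / 2) * |Real.log ‖x‖| ^ (-((Real.sqrt (1 - 4 * α) - 1) / 2))

end HardyLeray

end

/-!
Nonexistence and sharpness for the Hardy–Leray inequality in a punctured ball.

In the variable `t = -log|x|` and with `u = |x|^((2-N)/2) v`, the operator `-Δ - (N-2)²/4 |x|⁻²`
becomes `|x|⁻²` times `-∂²/∂t²` minus the spherical Laplacian of `v`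
(`laplacian_emdenFowler` is the radial case), the Leray term becomes `α t⁻² v`, and the weighted
`L²` condition becomes `∫ t^(-2γ) v² dt < ∞` near `t = ∞`.

*Nonexistence.* As `u ≥ 0`, one may decrease `α` to `1/4 - β²` with `β = 1 - γ ≥ 0`. Radial test
functions suffice, and neither spherical means nor regularity of `u` are needed. For a test function
`φ = |x|^((2-N)/2) t^(1/2+β) χ(s)` with `s = log t - a`, the adjoint operator gives a positive
weight times `χ'' + 2βχ'` (`laplacian_emdenFowler_powerProfile`). There is a smooth `χ ≥ 0`,
vanishing for `s ≤ 0`, with `χ'' + 2βχ' > 0` for `s > 0`, whose slope and whose multiple `2βχ` are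
bounded: a convex function of the solution `∫₀ˢ e^(-2βσ) dσ` of the homogeneous equation.
Truncating `χ` at scale `n` costs an error of size `C/n` on `n ≤ s ≤ 2n`
(`exists_truncated_subsolution`). By the `L²` condition, `u` times the weight and `1/s` is integrable
on `{s ≥ 1}` (`integrableOn_mul_testWeight_div`), so the errors vanish in the limit and the
inequality says that the integral of a positive multiple of `u` over `{s > 0}` is nonpositive. Hence
`u = 0` there (`IsSupersolution.ae_eq_zero_of_exp_lt`), and `e^a` may be taken arbitrarily close to
`-log R`.

*Sharpness.* The explicit solution corresponds to `v = t^(-δ)` with `δ(δ+1) = -α`, a classical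
solution of `v'' + α t⁻² v = 0`; integration by parts against test functions
(`setIntegral_mul_laplacian`) makes it a distributional one. Its weighted `L²` norm is the integral
of `t^(-2δ-2γ)` at infinity, finite exactly when `2δ + 2γ > 1`.
-/

namespace HardyLeray

open Filter Topology

/-! ### The Laplacian of a radial function -/

/-- The chain rule `Δ(g(|x|²)) = 4|x|² g''(|x|²) + 2 dim(V) g'(|x|²)`. -/
theorem laplacian_comp_norm_sq {V : Type*} [NormedAddCommGroup V] [InnerProductSpace ℝ V]
    [FiniteDimensional ℝ V] {g g' : ℝ → ℝ} {g'' : ℝ} {x : V}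
    (h1 : ∀ᶠ q in 𝓝 (‖x‖ ^ 2), HasDerivAt g (g' q) q)
    (h2 : HasDerivAt g' g'' (‖x‖ ^ 2)) :
    Laplacian.laplacian (fun y : V => g (‖y‖ ^ 2)) x =
      4 * ‖x‖ ^ 2 * g'' + 2 * (Module.finrank ℝ V) * g' (‖x‖ ^ 2) := by
  -- over `ℝ` the semilinear map `innerSL ℝ` is linear; `I` is its linear form
  obtain ⟨I, hI⟩ : ∃ I : V →L[ℝ] V →L[ℝ] ℝ, ∀ v, I v = innerSL ℝ v := ⟨innerSL ℝ, fun _ => rfl⟩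
  have hq : ∀ y : V, HasFDerivAt (fun y : V => ‖y‖ ^ 2) (2 • I y) y := fun y =>
    hI y ▸ (hasStrictFDerivAt_norm_sq y).hasFDerivAt
  have hc : Tendsto (fun y : V => ‖y‖ ^ 2) (𝓝 x) (𝓝 (‖x‖ ^ 2)) :=
    (hq x).continuousAt
  have hf1 : fderiv ℝ (fun y : V => g (‖y‖ ^ 2)) =ᶠ[𝓝 x]
      fun y => g' (‖y‖ ^ 2) • (2 • I y) := by
    filter_upwards [hc.eventually h1] with y hy
    exact (hy.comp_hasFDerivAt y (hq y)).fderiv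
  have hf2 : HasFDerivAt (fun y : V => g' (‖y‖ ^ 2) • ((2 : ℕ) • I y))
      (g' (‖x‖ ^ 2) • ((2 : ℕ) • I) +
        (g'' • (2 • I x)).smulRight ((2 : ℕ) • I x)) x :=
    (h2.comp_hasFDerivAt x (hq x)).smul
      ((2 : ℕ) • I).hasFDerivAt
  rw [InnerProductSpace.laplacian_eq_iteratedFDeriv_stdOrthonormalBasis]
  simp only [iteratedFDeriv_two_apply, hf1.fderiv_eq, hf2.fderiv]
  have key : ∀ i, (g' (‖x‖ ^ 2) • ((2 : ℕ) • I) +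
        (g'' • (2 • I x)).smulRight ((2 : ℕ) • I x))
        (stdOrthonormalBasis ℝ V i) (stdOrthonormalBasis ℝ V i) =
      2 * g' (‖x‖ ^ 2) + 4 * g'' * (inner ℝ (stdOrthonormalBasis ℝ V i) x) ^ 2 := by
    intro i
    have : inner ℝ (stdOrthonormalBasis ℝ V i) (stdOrthonormalBasis ℝ V i) = (1 : ℝ) := by
      rw [real_inner_self_eq_norm_sq, (stdOrthonormalBasis ℝ V).orthonormal.1 i]; norm_num
    simp only [add_apply, smul_apply,
      ContinuousLinearMap.smulRight_apply, hI, innerSL_apply_apply, this, nsmul_eq_mul, smul_eq_mul,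
      real_inner_comm x]
    push_cast
    ring
  simp only [Matrix.cons_val_zero, Matrix.cons_val_one]
  rw [Finset.sum_congr rfl fun i _ => key i, Finset.sum_add_distrib,
    ← Finset.mul_sum _ _ (4 * g'')]
  have hsum : ∑ i, (inner ℝ (stdOrthonormalBasis ℝ V i) x) ^ 2 = ‖x‖ ^ 2 := by
    have := (stdOrthonormalBasis ℝ V).sum_sq_norm_inner_right x
    simpa using this
  rw [hsum]
  simp
  ring

/-- The Emden–Fowler transform: the radial function `|x|^((2-N)/2) f(t)`, `t = -log|x|`. -/
noncomputable def emdenFowler (N : ℕ) (f : ℝ → ℝ) (x : E N) : ℝ :=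
  ‖x‖ ^ ((2 - (N : ℝ)) / 2) * f (-Real.log ‖x‖)

/-- In the variable `t = -log|x|` the operator `Δ + (N-2)²/4 |x|⁻²` on radial functions becomes
`|x|⁻² d²/dt²`. -/
theorem laplacian_emdenFowler {N : ℕ} {f f' : ℝ → ℝ} {f'' : ℝ} {x : E N} (hx : x ≠ 0)
    (h1 : ∀ᶠ t in 𝓝 (-Real.log ‖x‖), HasDerivAt f (f' t) t)
    (h2 : HasDerivAt f' f'' (-Real.log ‖x‖)) :
    Laplacian.laplacian (emdenFowler N f) x =
      ‖x‖ ^ ((2 - (N : ℝ)) / 2) * ‖x‖ ^ (-2 : ℤ) *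
        (f'' - ((N : ℝ) - 2) ^ 2 / 4 * f (-Real.log ‖x‖)) := by
  have hr : 0 < ‖x‖ := norm_pos_iff.2 hx
  have hq0 : 0 < ‖x‖ ^ 2 := by positivity
  set c : ℝ := (2 - (N : ℝ)) / 4 with hc
  have hlog : ∀ r : ℝ, -(Real.log (r ^ 2) / 2) = -Real.log r := fun r => by
    rw [Real.log_pow]; push_cast; ring
  have hpow : ∀ r : ℝ, 0 ≤ r → (r ^ 2) ^ c = r ^ ((2 - (N : ℝ)) / 2) := fun r hr => by
    rw [← Real.rpow_natCast, ← Real.rpow_mul hr]; congr 1; rw [hc]; push_cast; ring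
  have hfun : emdenFowler N f = fun y : E N =>
      (fun q : ℝ => q ^ c * f (-(Real.log q / 2))) (‖y‖ ^ 2) := by
    ext y
    simp only [emdenFowler, hlog, hpow _ (norm_nonneg y)]
  have hT : ∀ q : ℝ, 0 < q → HasDerivAt (fun q : ℝ => -(Real.log q / 2)) (-(q⁻¹ / 2)) q :=
    fun q hq => ((Real.hasDerivAt_log hq.ne').div_const 2).neg
  have hP : ∀ (p q : ℝ), 0 < q → HasDerivAt (fun q : ℝ => q ^ p) (p * q ^ (p - 1)) q :=
    fun p q hq => Real.hasDerivAt_rpow_const (Or.inl hq.ne')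
  have hTc : Tendsto (fun q : ℝ => -(Real.log q / 2)) (𝓝 (‖x‖ ^ 2)) (𝓝 (-Real.log ‖x‖)) := by
    have := (hT _ hq0).continuousAt.tendsto
    rwa [hlog] at this
  rw [hfun, laplacian_comp_norm_sq (g := fun q : ℝ => q ^ c * f (-(Real.log q / 2)))
    (g' := fun q => q ^ (c - 1) * (c * f (-(Real.log q / 2)) - f' (-(Real.log q / 2)) / 2))
    (g'' := (c - 1) * (‖x‖ ^ 2) ^ (c - 1 - 1) *
        (c * f (-Real.log ‖x‖) - f' (-Real.log ‖x‖) / 2) +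
      (‖x‖ ^ 2) ^ (c - 1) * (c * (f' (-Real.log ‖x‖) * (-((‖x‖ ^ 2)⁻¹ / 2))) -
        f'' * (-((‖x‖ ^ 2)⁻¹ / 2)) / 2))]
  · have e1 : (‖x‖ ^ 2) ^ (c - 1) = ‖x‖ ^ ((2 - (N : ℝ)) / 2) * (‖x‖ ^ 2)⁻¹ := by
      rw [Real.rpow_sub_one hq0.ne', hpow _ hr.le]; rfl
    have e2 : (‖x‖ ^ 2) ^ (c - 1 - 1) =
        ‖x‖ ^ ((2 - (N : ℝ)) / 2) * (‖x‖ ^ 2)⁻¹ * (‖x‖ ^ 2)⁻¹ := by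
      rw [Real.rpow_sub_one hq0.ne', e1]; rfl
    have e3 : ‖x‖ ^ (-2 : ℤ) = (‖x‖ ^ 2)⁻¹ := by
      rw [zpow_neg]; norm_cast
    simp only [e1, e2, e3, hlog, finrank_euclideanSpace_fin]
    rw [hc]
    field_simp
    ring
  · filter_upwards [hTc.eventually h1, lt_mem_nhds hq0] with q hq hq'
    have := (hP c q hq').mul (hq.comp q (hT q hq'))
    refine this.congr_deriv ?_
    simp only [Function.comp]
    rw [Real.rpow_sub_one hq'.ne']
    field_simp
    ring
  · have hf : HasDerivAt f (f' (-Real.log ‖x‖)) (-(Real.log (‖x‖ ^ 2) / 2)) := by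
      rw [hlog]; exact h1.self_of_nhds
    have hf' : HasDerivAt f' f'' (-(Real.log (‖x‖ ^ 2) / 2)) := by
      rw [hlog]; exact h2
    have hfT := HasDerivAt.comp (h := fun q : ℝ => -(Real.log q / 2)) (‖x‖ ^ 2) hf (hT _ hq0)
    have hfT' := HasDerivAt.comp (h := fun q : ℝ => -(Real.log q / 2)) (‖x‖ ^ 2) hf' (hT _ hq0)
    have := (hP (c - 1) _ hq0).mul ((hfT.const_mul c).sub (hfT'.div_const 2))
    refine this.congr_deriv ?_
    simp only [Function.comp, hlog, Pi.sub_apply]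

theorem contDiffAt_emdenFowler {N : ℕ} {f : ℝ → ℝ} {n : WithTop ℕ∞} {x : E N} (hx : x ≠ 0)
    (hf : ContDiffAt ℝ n f (-Real.log ‖x‖)) : ContDiffAt ℝ n (emdenFowler N f) x := by
  have h0 : ContDiffAt ℝ n (fun y : E N => ‖y‖) x := contDiffAt_norm ℝ hx
  have hr : ‖x‖ ≠ 0 := norm_ne_zero_iff.2 hx
  refine (h0.rpow_const_of_ne hr).mul ?_
  exact ContDiffAt.comp x hf ((h0.log hr).neg)

/-! ### A slowly truncated strict subsolution on the half-line -/

/-- The primitive `∫₀ˢ e^(-2βτ) dτ`, a solution of `y'' + 2βy' = 0`. -/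
noncomputable def expPrimitive (β s : ℝ) : ℝ :=
  if β = 0 then s else (1 - Real.exp (-2 * β * s)) / (2 * β)

theorem hasDerivAt_expPrimitive (β s : ℝ) :
    HasDerivAt (expPrimitive β) (Real.exp (-2 * β * s)) s := by
  unfold expPrimitive
  split_ifs with h
  · simpa [h] using hasDerivAt_id' s
  · have := ((((hasDerivAt_id' s).const_mul (-2 * β)).exp).const_sub 1).div_const (2 * β)
    refine this.congr_deriv ?_
    field_simp

theorem contDiff_expPrimitive (β : ℝ) : ContDiff ℝ ∞ (expPrimitive β) := by
  unfold expPrimitive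
  split_ifs with h
  · exact contDiff_id
  · fun_prop

theorem two_mul_expPrimitive (β s : ℝ) :
    2 * β * expPrimitive β s = 1 - Real.exp (-2 * β * s) := by
  unfold expPrimitive
  split_ifs with h
  · simp [h]
  · field_simp

theorem expPrimitive_zero (β : ℝ) : expPrimitive β 0 = 0 := by simp [expPrimitive]

theorem strictMono_expPrimitive (β : ℝ) : StrictMono (expPrimitive β) :=
  strictMono_of_deriv_pos fun s => by
    rw [(hasDerivAt_expPrimitive β s).deriv]; exact Real.exp_pos _

theorem expPrimitive_le {β : ℝ} (hβ : 0 ≤ β) (s : ℝ) : expPrimitive β s ≤ s := by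
  unfold expPrimitive
  split_ifs with h
  · exact le_rfl
  · have hb : 0 < β := lt_of_le_of_ne hβ (Ne.symm h)
    rw [div_le_iff₀ (by positivity)]
    have := Real.add_one_le_exp (-2 * β * s)
    linarith

/-- The function `s e^(-1/s)` for `s > 0`, extended by zero: smooth, convex and of slope at
most one. -/
noncomputable def convexGlue (s : ℝ) : ℝ := s * expNegInvGlue s

theorem hasDerivAt_convexGlue (s : ℝ) :
    HasDerivAt convexGlue ((1 + s⁻¹) * expNegInvGlue s) s := by
  have h := expNegInvGlue.hasDerivAt_polynomial_eval_inv_mul 1 s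
  simp only [Polynomial.eval_one, one_mul, Polynomial.derivative_one, sub_zero, mul_one,
    Polynomial.eval_pow, Polynomial.eval_X] at h
  refine ((hasDerivAt_id' s).mul h).congr_deriv ?_
  -- at `s = 0` the formula holds because `0⁻¹ = 0` and both factors vanish
  rcases eq_or_ne s 0 with rfl | hs
  · simp
  · field_simp

theorem hasDerivAt_deriv_convexGlue (s : ℝ) :
    HasDerivAt (fun s : ℝ => (1 + s⁻¹) * expNegInvGlue s) (s⁻¹ ^ 3 * expNegInvGlue s) s := by
  have h := expNegInvGlue.hasDerivAt_polynomial_eval_inv_mul (1 + Polynomial.X) s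
  simp only [Polynomial.eval_add, Polynomial.eval_one, Polynomial.eval_X] at h
  refine h.congr_deriv ?_
  simp
  left
  ring

theorem contDiff_convexGlue : ContDiff ℝ ∞ convexGlue :=
  contDiff_id.mul expNegInvGlue.contDiff

theorem expNegInvGlue_le_one (s : ℝ) : expNegInvGlue s ≤ 1 := by
  rcases le_or_gt s 0 with hs | hs
  · rw [expNegInvGlue.zero_of_nonpos hs]; exact zero_le_one
  · rw [expNegInvGlue, if_neg hs.not_ge, Real.exp_le_one_iff]
    have := inv_pos.2 hs
    linarith

theorem deriv_convexGlue_nonneg (s : ℝ) : 0 ≤ (1 + s⁻¹) * expNegInvGlue s := by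
  rcases le_or_gt s 0 with hs | hs
  · simp [expNegInvGlue.zero_of_nonpos hs]
  · exact mul_nonneg (by positivity) (expNegInvGlue.nonneg s)

theorem deriv_convexGlue_le_one (s : ℝ) : (1 + s⁻¹) * expNegInvGlue s ≤ 1 := by
  rcases le_or_gt s 0 with hs | hs
  · simp [expNegInvGlue.zero_of_nonpos hs]
  · rw [expNegInvGlue, if_neg hs.not_ge, Real.exp_neg, ← div_eq_mul_inv,
      div_le_one (Real.exp_pos _)]
    linarith [Real.add_one_le_exp s⁻¹]

theorem second_deriv_convexGlue_nonneg (s : ℝ) : 0 ≤ s⁻¹ ^ 3 * expNegInvGlue s := by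
  rcases le_or_gt s 0 with hs | hs
  · simp [expNegInvGlue.zero_of_nonpos hs]
  · exact mul_nonneg (by positivity) (expNegInvGlue.nonneg s)

/-- For every `β ≥ 0` there are nonnegative functions `χₙ` supported in `[0, 2n]` for which
`χₙ'' + 2βχₙ'` is, on `(0, n)`, a positive function `ρ` independent of `n`, and is at least `-C/s`
on `[n, ∞)`. They are obtained by truncating `χ = convexGlue ∘ expPrimitive β` at scale `n`. In the
variable `y = expPrimitive β s`, which solves the homogeneous equation, positivity of `χ'' + 2βχ'`
is strict convexity; the error is only of order `1/n` because `χ'` and `2βχ` are bounded. -/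
theorem exists_truncated_subsolution {β : ℝ} (hβ : 0 ≤ β) :
    ∃ (C : ℝ) (ρ : ℝ → ℝ) (χ : ℕ → ℝ → ℝ), (∀ s, 0 < s → 0 < ρ s) ∧ ∀ n, 1 ≤ n →
      ContDiff ℝ ∞ (χ n) ∧ ∀ s,
        0 ≤ χ n s ∧ (s ≤ 0 → χ n s = 0) ∧ (2 * n ≤ s → χ n s = 0) ∧
        (0 < s → s < n → deriv (deriv (χ n)) s + 2 * β * deriv (χ n) s = ρ s) ∧
        (s < n → 0 ≤ deriv (deriv (χ n)) s + 2 * β * deriv (χ n) s) ∧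
        (n ≤ s → -(C / s) ≤ deriv (deriv (χ n)) s + 2 * β * deriv (χ n) s) := by
  set e : ℝ → ℝ := fun s => Real.exp (-2 * β * s) with he
  have he' : ∀ s, HasDerivAt e (-2 * β * e s) s := fun s => by
    refine (((hasDerivAt_id' s).const_mul (-2 * β)).exp).congr_deriv ?_
    simp only [he]; ring
  set τ := expPrimitive β with hτ
  have hτ' : ∀ s, HasDerivAt τ (e s) s := hasDerivAt_expPrimitive β
  set P1 : ℝ → ℝ := fun s => (1 + s⁻¹) * expNegInvGlue s with hP1
  set P2 : ℝ → ℝ := fun s => s⁻¹ ^ 3 * expNegInvGlue s with hP2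
  -- the untruncated function and its derivatives
  set A : ℝ → ℝ := fun s => convexGlue (τ s) with hA
  set A1 : ℝ → ℝ := fun s => P1 (τ s) * e s with hA1
  have dA : ∀ s, HasDerivAt A (A1 s) s := fun s => (hasDerivAt_convexGlue (τ s)).comp s (hτ' s)
  have dA1 : ∀ s, HasDerivAt A1 (P2 (τ s) * e s ^ 2 - 2 * β * A1 s) s := fun s => by
    refine (((hasDerivAt_deriv_convexGlue (τ s)).comp s (hτ' s)).mul (he' s)).congr_deriv ?_
    simp only [hA1, hP1, hP2, Function.comp]
    ring
  -- the cutoff: `1` for `y ≤ 1` and `0` for `y ≥ 2`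
  set η : ℝ → ℝ := fun y => Real.smoothTransition (2 - y) with hη
  have hηs : ContDiff ℝ ∞ η := Real.smoothTransition.contDiff.comp (contDiff_const.sub contDiff_id)
  have hηs' : ContDiff ℝ ∞ (deriv η) := (contDiff_infty_iff_deriv.1 hηs).2
  have hηs'' : ContDiff ℝ ∞ (deriv (deriv η)) := (contDiff_infty_iff_deriv.1 hηs').2
  have dη : ∀ y, HasDerivAt η (deriv η y) y := fun y =>
    (hηs.differentiable (by simp) y).hasDerivAt
  have dη' : ∀ y, HasDerivAt (deriv η) (deriv (deriv η) y) y := fun y =>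
    (hηs'.differentiable (by simp) y).hasDerivAt
  have hη0 : ∀ y, 0 ≤ η y := fun y => Real.smoothTransition.nonneg _
  have hη1 : ∀ y, y ≤ 1 → η y = 1 := fun y hy =>
    Real.smoothTransition.one_of_one_le (by linarith)
  have hη2 : ∀ y, 2 ≤ y → η y = 0 := fun y hy =>
    Real.smoothTransition.zero_of_nonpos (by linarith)
  have hlt : ∀ y, y < 1 → deriv η y = 0 ∧ deriv (deriv η) y = 0 := by
    have h1 : ∀ y, y < 1 → deriv η y = 0 := fun y hy => by
      have : η =ᶠ[𝓝 y] fun _ => 1 := by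
        filter_upwards [gt_mem_nhds hy] with z hz using hη1 z hz.le
      rw [this.deriv_eq]; simp
    refine fun y hy => ⟨h1 y hy, ?_⟩
    have : deriv η =ᶠ[𝓝 y] fun _ => 0 := by
      filter_upwards [gt_mem_nhds hy] with z hz using h1 z hz
    rw [this.deriv_eq]; simp
  have hgt : ∀ y, 2 < y → deriv η y = 0 ∧ deriv (deriv η) y = 0 := by
    have h1 : ∀ y, 2 < y → deriv η y = 0 := fun y hy => by
      have : η =ᶠ[𝓝 y] fun _ => 0 := by
        filter_upwards [lt_mem_nhds hy] with z hz using hη2 z hz.le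
      rw [this.deriv_eq]; simp
    refine fun y hy => ⟨h1 y hy, ?_⟩
    have : deriv η =ᶠ[𝓝 y] fun _ => 0 := by
      filter_upwards [lt_mem_nhds hy] with z hz using h1 z hz
    rw [this.deriv_eq]; simp
  obtain ⟨M, hM0, hM1, hM2⟩ : ∃ M, 0 ≤ M ∧ (∀ y, |deriv η y| ≤ M) ∧
      ∀ y, |deriv (deriv η) y| ≤ M := by
    obtain ⟨M1, h1⟩ := (isCompact_Icc (a := (1 : ℝ)) (b := 2)).exists_bound_of_continuousOn
      hηs'.continuous.continuousOn
    obtain ⟨M2, h2⟩ := (isCompact_Icc (a := (1 : ℝ)) (b := 2)).exists_bound_of_continuousOn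
      hηs''.continuous.continuousOn
    refine ⟨max 0 (max M1 M2), le_max_left _ _, fun y => ?_, fun y => ?_⟩
    · rcases lt_or_ge y 1 with h | h
      · simp [(hlt y h).1]
      rcases lt_or_ge 2 y with h' | h'
      · simp [(hgt y h').1]
      · exact (h1 y ⟨h, h'⟩).trans ((le_max_left _ _).trans (le_max_right _ _))
    · rcases lt_or_ge y 1 with h | h
      · simp [(hlt y h).2]
      rcases lt_or_ge 2 y with h' | h'
      · simp [(hgt y h').2]
      · exact (h2 y ⟨h, h'⟩).trans ((le_max_right _ _).trans (le_max_right _ _))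
  have hτpos : ∀ s, 0 < s → 0 < τ s := fun s hs => by
    rw [← expPrimitive_zero β]; exact strictMono_expPrimitive β hs
  have hτneg : ∀ s, s ≤ 0 → τ s ≤ 0 := fun s hs => by
    rw [← expPrimitive_zero β]; exact (strictMono_expPrimitive β).monotone hs
  have hA0 : ∀ s, s ≤ 0 → A s = 0 := fun s hs => by
    simp [hA, convexGlue, expNegInvGlue.zero_of_nonpos (hτneg s hs)]
  have hAnn : ∀ s, 0 ≤ A s := fun s => by
    rcases le_or_gt s 0 with hs | hs
    · rw [hA0 s hs]
    · exact mul_nonneg (hτpos s hs).le (expNegInvGlue.nonneg _)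
  have hepos : ∀ s, 0 < e s := fun s => Real.exp_pos _
  refine ⟨10 * M, fun s => P2 (τ s) * e s ^ 2, fun n s => A s * η (s / n), ?_, ?_⟩
  · intro s hs
    have h1 := hτpos s hs
    have h2 := expNegInvGlue.pos_of_pos h1
    have h3 := hepos s
    simp only [hP2]
    positivity
  intro n hn
  have hn' : (0 : ℝ) < n := by exact_mod_cast hn
  have d1 : ∀ s, HasDerivAt (fun s => A s * η (s / n))
      (A1 s * η (s / n) + A s * (deriv η (s / n) / n)) s := fun s => by
    have := (dη (s / n)).comp s ((hasDerivAt_id' s).div_const (n : ℝ))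
    refine ((dA s).mul this).congr_deriv ?_
    simp only [Function.comp]; ring
  have d2 : ∀ s, HasDerivAt (fun s => A1 s * η (s / n) + A s * (deriv η (s / n) / n))
      ((P2 (τ s) * e s ^ 2 - 2 * β * A1 s) * η (s / n) + 2 * A1 s * (deriv η (s / n) / n) +
        A s * (deriv (deriv η) (s / n) / n ^ 2)) s := fun s => by
    have h1 := (dη (s / n)).comp s ((hasDerivAt_id' s).div_const (n : ℝ))
    have h2 := ((dη' (s / n)).comp s ((hasDerivAt_id' s).div_const (n : ℝ))).div_const (n : ℝ)
    refine (((dA1 s).mul h1).add ((dA s).mul h2)).congr_deriv ?_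
    simp only [Function.comp]; field_simp; ring
  have e1 : deriv (fun s => A s * η (s / n)) =
      fun s => A1 s * η (s / n) + A s * (deriv η (s / n) / n) := funext fun s => (d1 s).deriv
  have hL : ∀ s, deriv (deriv (fun s => A s * η (s / n))) s +
      2 * β * deriv (fun s => A s * η (s / n)) s = P2 (τ s) * e s ^ 2 * η (s / n) +
        (2 * A1 s * (deriv η (s / n) / n) + A s * (deriv (deriv η) (s / n) / n ^ 2) +
          2 * β * A s * (deriv η (s / n) / n)) := fun s => by
    rw [e1, (d2 s).deriv]; ring
  have hmain : ∀ s, 0 ≤ P2 (τ s) * e s ^ 2 := fun s =>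
    mul_nonneg (second_deriv_convexGlue_nonneg _) (sq_nonneg _)
  have hL1 : ∀ s : ℝ, s < n → deriv (deriv (fun s => A s * η (s / n))) s +
      2 * β * deriv (fun s => A s * η (s / n)) s = P2 (τ s) * e s ^ 2 := fun s hs => by
    have : s / n < 1 := (div_lt_one hn').2 hs
    rw [hL, hη1 _ this.le, (hlt _ this).1, (hlt _ this).2]; simp
  refine ⟨?_, fun s => ⟨mul_nonneg (hAnn s) (hη0 _), fun hs => ?_, fun hs => ?_,
    fun _ hs => hL1 s hs, fun hs => ?_, fun hs => ?_⟩⟩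
  · exact (contDiff_convexGlue.comp (contDiff_expPrimitive β)).mul
      (hηs.comp (contDiff_id.div_const _))
  · simp [hA0 s hs]
  · simp [hη2 (s / n) ((le_div_iff₀ hn').2 hs)]
  · rw [hL1 s hs]; exact hmain s
  · have hs0 : 0 < s := hn'.trans_le hs
    rw [hL]
    have hge : 0 ≤ P2 (τ s) * e s ^ 2 * η (s / n) := mul_nonneg (hmain s) (hη0 _)
    rcases lt_or_ge 2 (s / n) with h | h
    · rw [(hgt _ h).1, (hgt _ h).2]
      have : 0 ≤ 10 * M / s := by positivity
      simp only [zero_div, mul_zero, add_zero]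
      linarith
    -- on `[n, 2n]` each of the three error terms is at most a multiple of `M / n ≤ 2M / s`
    have hs2 : s ≤ 2 * n := (div_le_iff₀ hn').1 h
    have hd1 := hM1 (s / n)
    have hd2 := hM2 (s / n)
    have he1 : e s ≤ 1 := by
      simp only [he, Real.exp_le_one_iff]; nlinarith [mul_nonneg hβ hs0.le]
    have hA1n : 0 ≤ A1 s := mul_nonneg (deriv_convexGlue_nonneg _) (hepos s).le
    have hA11 : A1 s ≤ 1 :=
      mul_le_one₀ (deriv_convexGlue_le_one _) (hepos s).le he1
    have hAτ : A s ≤ τ s := mul_le_of_le_one_right (hτpos s hs0).le (expNegInvGlue_le_one _)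
    have hAs : A s ≤ 2 * n := (hAτ.trans (expPrimitive_le hβ s)).trans hs2
    have hAβ : 2 * β * A s ≤ 1 := by
      have := two_mul_expPrimitive β s
      have h2 := hepos s
      simp only [he] at h2
      have h3 : 2 * β * A s ≤ 2 * β * τ s := mul_le_mul_of_nonneg_left hAτ (by positivity)
      linarith
    have hAβ0 : 0 ≤ 2 * β * A s := mul_nonneg (by positivity) (hAnn s)
    have b1 : |2 * A1 s * (deriv η (s / n) / n)| ≤ 2 * 1 * (M / n) := by
      rw [abs_mul, abs_div, abs_of_pos hn', abs_of_nonneg (by positivity : 0 ≤ 2 * A1 s)]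
      gcongr
    have b2 : |A s * (deriv (deriv η) (s / n) / n ^ 2)| ≤ 2 * n * (M / n ^ 2) := by
      rw [abs_mul, abs_div, abs_of_pos (by positivity : (0 : ℝ) < n ^ 2), abs_of_nonneg (hAnn s)]
      gcongr
    have b3 : |2 * β * A s * (deriv η (s / n) / n)| ≤ 1 * (M / n) := by
      rw [abs_mul, abs_div, abs_of_pos hn', abs_of_nonneg hAβ0]
      gcongr
    have b4 : M / n ≤ 2 * M / s := by
      rw [div_le_div_iff₀ hn' hs0]; nlinarith
    have b5 : 2 * n * (M / n ^ 2) = 2 * (M / n) := by field_simp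
    have b6 : 10 * M / s = 5 * (2 * M / s) := by ring
    rw [b6]
    have := neg_le_of_abs_le b1
    have := neg_le_of_abs_le b2
    have := neg_le_of_abs_le b3
    linarith

/-! ### Test functions supported in an annulus -/

/-- The function `t^(1/2+β) χ(log t - a)` for `t > 0`, extended by zero. -/
noncomputable def powerProfile (β a : ℝ) (χ : ℝ → ℝ) (t : ℝ) : ℝ :=
  if 0 < t then t ^ (1 / 2 + β) * χ (Real.log t - a) else 0

theorem powerProfile_nonneg {β a : ℝ} {χ : ℝ → ℝ} (h : ∀ s, 0 ≤ χ s) (t : ℝ) :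
    0 ≤ powerProfile β a χ t := by
  unfold powerProfile
  split_ifs with ht
  · exact mul_nonneg (Real.rpow_nonneg ht.le _) (h _)
  · exact le_rfl

theorem powerProfile_of_le {β a : ℝ} {χ : ℝ → ℝ} (h : ∀ s, s ≤ 0 → χ s = 0) {t : ℝ}
    (ht : t ≤ Real.exp a) : powerProfile β a χ t = 0 := by
  unfold powerProfile
  split_ifs with h0
  · rw [h _ (by linarith [(Real.log_le_iff_le_exp h0).2 ht]), mul_zero]
  · rfl

theorem powerProfile_of_ge {β a b : ℝ} {χ : ℝ → ℝ} (h : ∀ s, b ≤ s → χ s = 0) {t : ℝ}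
    (ht : Real.exp (a + b) ≤ t) : powerProfile β a χ t = 0 := by
  have h0 : 0 < t := (Real.exp_pos _).trans_le ht
  rw [powerProfile, if_pos h0, h _ (by linarith [(Real.le_log_iff_exp_le h0).2 ht]), mul_zero]

theorem contDiff_powerProfile {β a : ℝ} {χ : ℝ → ℝ} (hχ : ContDiff ℝ ∞ χ)
    (h : ∀ s, s ≤ 0 → χ s = 0) : ContDiff ℝ ∞ (powerProfile β a χ) := by
  rw [contDiff_iff_contDiffAt]
  intro t
  rcases lt_or_ge t (Real.exp a) with ht | ht
  · have : powerProfile β a χ =ᶠ[𝓝 t] fun _ => 0 := by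
      filter_upwards [gt_mem_nhds ht] with z hz using powerProfile_of_le h hz.le
    exact contDiffAt_const.congr_of_eventuallyEq this
  · have h0 : 0 < t := (Real.exp_pos _).trans_le ht
    have : powerProfile β a χ =ᶠ[𝓝 t] fun t => t ^ (1 / 2 + β) * χ (Real.log t - a) := by
      filter_upwards [lt_mem_nhds h0] with z hz using if_pos hz
    refine ContDiffAt.congr_of_eventuallyEq ?_ this
    refine (Real.contDiffAt_rpow_const_of_ne h0.ne').mul ?_
    exact hχ.contDiffAt.comp t ((Real.contDiffAt_log.2 h0.ne').sub contDiffAt_const)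

/-- With `s = log t - a`, the operator `d²/dt² + (1/4 - β²) t⁻²` becomes
`t^(β-3/2) (d²/ds² + 2β d/ds)`. -/
theorem deriv_deriv_powerProfile {β a : ℝ} {χ : ℝ → ℝ} (hχ : ContDiff ℝ ∞ χ) {t : ℝ}
    (ht : 0 < t) :
    deriv (deriv (powerProfile β a χ)) t + (1 / 4 - β ^ 2) * t ^ (-2 : ℤ) * powerProfile β a χ t =
      t ^ (β - 3 / 2) *
        (deriv (deriv χ) (Real.log t - a) + 2 * β * deriv χ (Real.log t - a)) := by
  have hχ' : ContDiff ℝ ∞ (deriv χ) := (contDiff_infty_iff_deriv.1 hχ).2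
  have dχ : ∀ s, HasDerivAt χ (deriv χ s) s := fun s =>
    (hχ.differentiable (by simp) s).hasDerivAt
  have dχ' : ∀ s, HasDerivAt (deriv χ) (deriv (deriv χ) s) s := fun s =>
    (hχ'.differentiable (by simp) s).hasDerivAt
  have hl : ∀ z : ℝ, 0 < z → HasDerivAt (fun z => Real.log z - a) z⁻¹ z := fun z hz =>
    (Real.hasDerivAt_log hz.ne').sub_const a
  have hp : ∀ (p z : ℝ), 0 < z → HasDerivAt (fun z : ℝ => z ^ p) (p * z ^ (p - 1)) z :=
    fun p z hz => Real.hasDerivAt_rpow_const (Or.inl hz.ne')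
  have d1 : ∀ z : ℝ, 0 < z → HasDerivAt (powerProfile β a χ)
      (z ^ (β - 1 / 2) * ((1 / 2 + β) * χ (Real.log z - a) + deriv χ (Real.log z - a))) z := by
    intro z hz
    have : powerProfile β a χ =ᶠ[𝓝 z] fun t => t ^ (1 / 2 + β) * χ (Real.log t - a) := by
      filter_upwards [lt_mem_nhds hz] with y hy using if_pos hy
    refine (((hp _ z hz).mul
      (HasDerivAt.comp (h := fun z => Real.log z - a) z (dχ _) (hl z hz))).congr_of_eventuallyEq
        this).congr_deriv ?_
    have e1 : (1 / 2 + β - 1) = β - 1 / 2 := by ring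
    have e2 : z ^ (1 / 2 + β) = z ^ (β - 1 / 2) * z := by
      rw [← Real.rpow_add_one hz.ne']; congr 1; ring
    simp only [Function.comp]
    rw [e1, e2]
    field_simp
  have d1' : deriv (powerProfile β a χ) =ᶠ[𝓝 t] fun z =>
      z ^ (β - 1 / 2) * ((1 / 2 + β) * χ (Real.log z - a) + deriv χ (Real.log z - a)) := by
    filter_upwards [lt_mem_nhds ht] with z hz using (d1 z hz).deriv
  have d2 := (hp (β - 1 / 2) t ht).mul
    (((HasDerivAt.comp (h := fun z => Real.log z - a) t (dχ _) (hl t ht)).const_mul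
      (1 / 2 + β)).add (HasDerivAt.comp (h := fun z => Real.log z - a) t (dχ' _) (hl t ht)))
  have d2' : deriv (deriv (powerProfile β a χ)) t = _ :=
    (d2.congr_of_eventuallyEq d1').deriv
  rw [d2', powerProfile, if_pos ht]
  have e1 : t ^ (β - 1 / 2 - 1) = t ^ (β - 3 / 2) := by congr 1; ring
  have e2 : t ^ (β - 1 / 2) = t ^ (β - 3 / 2) * t := by
    rw [← Real.rpow_add_one ht.ne']; congr 1; ring
  have e3 : t ^ (1 / 2 + β) = t ^ (β - 3 / 2) * t * t := by
    rw [← Real.rpow_add_one ht.ne', ← Real.rpow_add_one ht.ne']; congr 1; ring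
  have e4 : t ^ (-2 : ℤ) = (t * t)⁻¹ := by rw [zpow_neg, ← sq]; norm_cast
  simp only [Function.comp, Pi.add_apply]
  rw [e1, e2, e3, e4]
  field_simp
  ring

theorem isTestFunction_emdenFowler {N : ℕ} {R t₁ t₂ : ℝ} {f : ℝ → ℝ} (hf : ContDiff ℝ ∞ f)
    (h1 : ∀ t, t ≤ t₁ → f t = 0) (h2 : ∀ t, t₂ ≤ t → f t = 0) (ht : 0 < t₁)
    (hR : Real.exp (-t₁) < R) :
    IsTestFunction (puncturedBall N R) (emdenFowler N f) := by
  have hzero : ∀ x : E N, ‖x‖ < Real.exp (-t₂) → emdenFowler N f x = 0 := by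
    intro x hx
    rcases eq_or_ne x 0 with rfl | hx0
    -- at the origin `log 0 = 0`, so `f` is evaluated at `0 ≤ t₁`
    · simp [emdenFowler, h1 0 ht.le]
    · have := (Real.log_lt_iff_lt_exp (norm_pos_iff.2 hx0)).2 hx
      rw [emdenFowler, h2 _ (by linarith), mul_zero]
  have hout : ∀ x : E N, Real.exp (-t₁) ≤ ‖x‖ → emdenFowler N f x = 0 := by
    intro x hx
    have := (Real.le_log_iff_exp_le ((Real.exp_pos _).trans_le hx)).2 hx
    rw [emdenFowler, h1 _ (by linarith), mul_zero]
  have hsupp : tsupport (emdenFowler N f) ⊆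
      closedBall (0 : E N) (Real.exp (-t₁)) \ ball 0 (Real.exp (-t₂)) := by
    refine closure_minimal (fun x hx => ⟨?_, fun h => ?_⟩) (isClosed_closedBall.sdiff isOpen_ball)
    · rw [mem_closedBall_zero_iff]
      by_contra h
      exact hx (hout x (not_le.1 h).le)
    · exact hx (hzero x (mem_ball_zero_iff.1 h))
  refine ⟨?_, ?_, fun x hx => ?_⟩
  · rw [contDiff_iff_contDiffAt]
    intro x
    rcases eq_or_ne x 0 with rfl | hx
    · have : emdenFowler N f =ᶠ[𝓝 0] fun _ => 0 := by
        filter_upwards [ball_mem_nhds (0 : E N) (Real.exp_pos (-t₂))] with y hy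
        exact hzero y (mem_ball_zero_iff.1 hy)
      exact contDiffAt_const.congr_of_eventuallyEq this
    · exact contDiffAt_emdenFowler hx hf.contDiffAt
  · exact (isCompact_closedBall (0 : E N) (Real.exp (-t₁))).of_isClosed_subset
      (isClosed_tsupport _) (hsupp.trans sdiff_subset)
  · refine ⟨closedBall_subset_ball hR (hsupp hx).1, ?_⟩
    rintro rfl
    exact (hsupp hx).2 (mem_ball_self (Real.exp_pos _))

/-! ### Integration by parts and integrability of the pairings -/

theorem isOpen_puncturedBall (N : ℕ) (R : ℝ) : IsOpen (puncturedBall N R) :=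
  isOpen_ball.sdiff isClosed_singleton

theorem norm_pos_of_mem_puncturedBall {N : ℕ} {R : ℝ} {x : E N} (hx : x ∈ puncturedBall N R) :
    0 < ‖x‖ := norm_pos_iff.2 hx.2

theorem neg_log_pos_of_mem_puncturedBall {N : ℕ} {R : ℝ} (hR1 : R ≤ 1) {x : E N}
    (hx : x ∈ puncturedBall N R) : 0 < -Real.log ‖x‖ :=
  neg_pos.2 (Real.log_neg (norm_pos_of_mem_puncturedBall hx)
    ((mem_ball_zero_iff.1 hx.1).trans_le hR1))

theorem laplacian_eq_zero_of_notMem_tsupport {N : ℕ} {φ : E N → ℝ} {x : E N}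
    (hx : x ∉ tsupport φ) : Laplacian.laplacian φ x = 0 := by
  have h : φ =ᶠ[𝓝 x] fun _ => 0 := notMem_tsupport_iff_eventuallyEq.1 hx
  rw [(InnerProductSpace.laplacian_congr_nhds h).self_of_nhds]
  simp

theorem continuous_laplacian {N : ℕ} {φ : E N → ℝ} (hφ : ContDiff ℝ ∞ φ) :
    Continuous (Laplacian.laplacian φ) := by
  rw [InnerProductSpace.laplacian_eq_iteratedFDeriv_stdOrthonormalBasis]
  refine continuous_finsetSum _ fun i _ => ?_
  exact (ContinuousMultilinearMap.apply ℝ (fun _ : Fin 2 => E N) ℝ _).continuous.comp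
    (hφ.continuous_iteratedFDeriv (by norm_cast))

/-- Integration by parts against a function which is smooth only on an open set containing the
support of the test function. -/
theorem setIntegral_mul_laplacian {N : ℕ} {Ω : Set (E N)} (hΩ : IsOpen Ω) {u φ : E N → ℝ}
    (hu : ∀ x ∈ Ω, ContDiffAt ℝ ∞ u x) (hφ : IsTestFunction Ω φ) :
    ∫ x in Ω, u x * Laplacian.laplacian φ x = ∫ x in Ω, Laplacian.laplacian u x * φ x := by
  -- `v = ζ u` is a global test function which agrees with `u` near the support of `φ`
  obtain ⟨K, hK, hφK, hKΩ⟩ := exists_compact_between hφ.hasCompactSupport hΩ hφ.tsupport_subset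
  obtain ⟨K', hK', hKK', hK'Ω⟩ := exists_compact_between hK hΩ hKΩ
  obtain ⟨ζ, hζ1, hζ0, -⟩ := exists_contMDiffMap_one_nhds_of_subset_interior (n := ⊤)
    (modelWithCornersSelf ℝ (E N)) hK.isClosed hKK'
  have hζs : ContDiff ℝ ∞ (ζ : E N → ℝ) := ζ.contMDiff.contDiff
  set v : E N → ℝ := fun x => u x * ζ x with hv
  have hvK' : ∀ x, x ∉ K' → v x = 0 := fun x hx => by simp [hv, hζ0 x hx]
  have hvs : ContDiff ℝ ∞ v := by
    rw [contDiff_iff_contDiffAt]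
    intro x
    by_cases hx : x ∈ Ω
    · exact (hu x hx).mul hζs.contDiffAt
    · have : v =ᶠ[𝓝 x] fun _ => 0 := by
        filter_upwards [hK'.isClosed.isOpen_compl.mem_nhds fun h => hx (hK'Ω h)] with y hy
        exact hvK' y hy
      exact contDiffAt_const.congr_of_eventuallyEq this
  have hvc : HasCompactSupport v := HasCompactSupport.intro hK' hvK'
  have huv : ∀ x ∈ tsupport φ, v =ᶠ[𝓝 x] u := fun x hx => by
    filter_upwards [isOpen_interior.mem_nhds (hφK hx)] with y hy
    have : ζ y = 1 := hζ1.self_of_nhdsSet y (interior_subset hy)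
    simp [hv, this]
  have h1 : ∀ x, v x * Laplacian.laplacian φ x = u x * Laplacian.laplacian φ x := fun x => by
    by_cases hx : x ∈ tsupport φ
    · rw [(huv x hx).self_of_nhds]
    · rw [laplacian_eq_zero_of_notMem_tsupport hx, mul_zero, mul_zero]
  have h2 : ∀ x, Laplacian.laplacian v x * φ x = Laplacian.laplacian u x * φ x := fun x => by
    by_cases hx : x ∈ tsupport φ
    · rw [(InnerProductSpace.laplacian_congr_nhds (huv x hx)).self_of_nhds]
    · rw [image_eq_zero_of_notMem_tsupport hx, mul_zero, mul_zero]
  have key := SchwartzMap.integral_mul_laplacian_right_eq_left (μ := volume)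
    (hvc.toSchwartzMap hvs) (hφ.hasCompactSupport.toSchwartzMap hφ.contDiff)
  simp only [SchwartzMap.laplacian_apply] at key
  rw [setIntegral_eq_integral_of_forall_compl_eq_zero,
    setIntegral_eq_integral_of_forall_compl_eq_zero]
  · rw [← integral_congr_ae (Eventually.of_forall h1),
      ← integral_congr_ae (Eventually.of_forall h2)]
    exact key
  · intro x hx
    rw [image_eq_zero_of_notMem_tsupport fun h => hx (hφ.tsupport_subset h), mul_zero]
  · intro x hx
    rw [laplacian_eq_zero_of_notMem_tsupport fun h => hx (hφ.tsupport_subset h), mul_zero]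

/-- The pairings in the definition of a solution are integrals of integrable functions. -/
theorem integrableOn_mul_of_tsupport {N : ℕ} {Ω : Set (E N)} (hΩ : IsOpen Ω) {u φ ψ : E N → ℝ}
    (hu : LocallyIntegrableOn u Ω volume) (hφ : IsTestFunction Ω φ) (hψ : ContinuousOn ψ Ω)
    (h0 : ∀ x, x ∉ tsupport φ → ψ x = 0) : IntegrableOn (fun x => u x * ψ x) Ω volume := by
  have h1 : IntegrableOn u (tsupport φ) volume :=
    hu.integrableOn_compact_subset hφ.tsupport_subset hφ.hasCompactSupport
  refine (h1.mul_continuousOn (hψ.mono hφ.tsupport_subset)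
    hφ.hasCompactSupport).of_forall_sdiff_eq_zero hΩ.measurableSet fun x hx => ?_
  rw [h0 x hx.2, mul_zero]

theorem continuousOn_norm_zpow_puncturedBall (N : ℕ) (R : ℝ) :
    ContinuousOn (fun x : E N => ‖x‖ ^ (-2 : ℤ)) (puncturedBall N R) :=
  continuous_norm.continuousOn.zpow₀ _ fun _ hx => Or.inl (norm_pos_of_mem_puncturedBall hx).ne'

theorem continuousOn_abs_log_zpow_puncturedBall (N : ℕ) {R : ℝ} (hR1 : R ≤ 1) :
    ContinuousOn (fun x : E N => |Real.log ‖x‖| ^ (-2 : ℤ)) (puncturedBall N R) := by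
  refine ContinuousOn.zpow₀ (ContinuousOn.abs (ContinuousOn.log continuous_norm.continuousOn
    fun x hx => (norm_pos_of_mem_puncturedBall hx).ne')) _ fun x hx => Or.inl ?_
  have := neg_log_pos_of_mem_puncturedBall hR1 hx
  exact abs_ne_zero.2 (by linarith)

/-- The weak inequality as the sign of a single integral. As `u ≥ 0`, the constant may be
decreased. -/
theorem IsSupersolution.setIntegral_nonpos {N : ℕ} {R α α' : ℝ} {u φ : E N → ℝ} (hR1 : R ≤ 1)
    (hu : IsSupersolution R α u) (hα : α' ≤ α)
    (hu0 : ∀ᵐ x ∂(volume.restrict (puncturedBall N R)), 0 ≤ u x)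
    (hφ : IsTestFunction (puncturedBall N R) φ) (hφ0 : ∀ x, 0 ≤ φ x) :
    IntegrableOn (fun x => u x * (Laplacian.laplacian φ x + (((N : ℝ) - 2) ^ 2 / 4 +
      α' * |Real.log ‖x‖| ^ (-2 : ℤ)) * ‖x‖ ^ (-2 : ℤ) * φ x)) (puncturedBall N R) volume ∧
    ∫ x in puncturedBall N R, u x * (Laplacian.laplacian φ x + (((N : ℝ) - 2) ^ 2 / 4 +
      α' * |Real.log ‖x‖| ^ (-2 : ℤ)) * ‖x‖ ^ (-2 : ℤ) * φ x) ≤ 0 := by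
  have hΩ := isOpen_puncturedBall N R
  have hv : ∀ x, x ∉ tsupport φ → φ x = 0 := fun x hx => image_eq_zero_of_notMem_tsupport hx
  have i1 := integrableOn_mul_of_tsupport hΩ hu.locallyIntegrableOn hφ
    (continuous_laplacian hφ.contDiff).continuousOn
    (fun x hx => laplacian_eq_zero_of_notMem_tsupport hx)
  have i2 := integrableOn_mul_of_tsupport hΩ hu.locallyIntegrableOn hφ
    (ψ := fun x => ‖x‖ ^ (-2 : ℤ) * φ x)
    ((continuousOn_norm_zpow_puncturedBall N R).mul hφ.contDiff.continuous.continuousOn)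
    (fun x hx => by rw [hv x hx, mul_zero])
  have i3 := integrableOn_mul_of_tsupport hΩ hu.locallyIntegrableOn hφ
    (ψ := fun x => ‖x‖ ^ (-2 : ℤ) * |Real.log ‖x‖| ^ (-2 : ℤ) * φ x)
    (((continuousOn_norm_zpow_puncturedBall N R).mul
      (continuousOn_abs_log_zpow_puncturedBall N hR1)).mul hφ.contDiff.continuous.continuousOn)
    (fun x hx => by rw [hv x hx, mul_zero])
  have hsplit : (fun x => u x * (Laplacian.laplacian φ x + (((N : ℝ) - 2) ^ 2 / 4 +
      α' * |Real.log ‖x‖| ^ (-2 : ℤ)) * ‖x‖ ^ (-2 : ℤ) * φ x)) = fun x =>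
      (u x * Laplacian.laplacian φ x + ((N : ℝ) - 2) ^ 2 / 4 * (u x * (‖x‖ ^ (-2 : ℤ) * φ x))) +
        α' * (u x * (‖x‖ ^ (-2 : ℤ) * |Real.log ‖x‖| ^ (-2 : ℤ) * φ x)) := by
    ext x; ring
  rw [hsplit]
  have i12 : IntegrableOn (fun x => u x * Laplacian.laplacian φ x +
      ((N : ℝ) - 2) ^ 2 / 4 * (u x * (‖x‖ ^ (-2 : ℤ) * φ x))) (puncturedBall N R) volume :=
    i1.add (i2.const_mul _)
  have i3' := i3.const_mul α'
  refine ⟨i12.add i3', ?_⟩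
  rw [integral_add i12 i3', integral_add i1 (i2.const_mul _), integral_const_mul,
    integral_const_mul]
  have h := hu.inequality φ hφ hφ0
  have e2 : ∫ x in puncturedBall N R, ‖x‖ ^ (-2 : ℤ) * u x * φ x =
      ∫ x in puncturedBall N R, u x * (‖x‖ ^ (-2 : ℤ) * φ x) := by
    congr 1; ext x; ring
  have e3 : lerayPairing (puncturedBall N R) u φ = ∫ x in puncturedBall N R,
      u x * (‖x‖ ^ (-2 : ℤ) * |Real.log ‖x‖| ^ (-2 : ℤ) * φ x) := by
    unfold lerayPairing; congr 1; ext x; ring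
  have h3 : 0 ≤ ∫ x in puncturedBall N R,
      u x * (‖x‖ ^ (-2 : ℤ) * |Real.log ‖x‖| ^ (-2 : ℤ) * φ x) := by
    refine integral_nonneg_of_ae ?_
    filter_upwards [hu0] with x hx
    have := hφ0 x
    simp only [Pi.zero_apply]
    positivity
  rw [hardyPairing, e2, e3] at h
  have := mul_le_mul_of_nonneg_right hα h3
  linarith

/-! ### Integrability in the logarithmic variable -/

/-- Polar coordinates and `t = -log|x|`: the measure `|x|^(-N) dx` on a ball corresponds to `dt`
on a half-line. -/
theorem integrableOn_ball_iff_neg_log {N : ℕ} (hN : N ≠ 0) (k : ℝ → ℝ) (T : ℝ) :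
    IntegrableOn (fun x : E N => ‖x‖ ^ (-N : ℤ) * k (-Real.log ‖x‖))
      (ball 0 (Real.exp (-T))) volume ↔ IntegrableOn k (Ioi T) volume := by
  have : Nonempty (Fin N) := ⟨⟨0, Nat.pos_of_ne_zero hN⟩⟩
  have himg : (fun t : ℝ => Real.exp (-t)) '' Ioi T = Ioo 0 (Real.exp (-T)) := by
    ext r
    simp only [mem_image, mem_Ioi, mem_Ioo]
    constructor
    · rintro ⟨t, ht, rfl⟩
      exact ⟨Real.exp_pos _, Real.exp_lt_exp.2 (neg_lt_neg ht)⟩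
    · rintro ⟨h0, h1⟩
      refine ⟨-Real.log r, ?_, by rw [neg_neg, Real.exp_log h0]⟩
      have := (Real.log_lt_iff_lt_exp h0).2 h1
      linarith
  rw [integrableOn_fun_norm_addHaar volume (f := fun r => r ^ (-N : ℤ) * k (-Real.log r)), ← himg,
    integrableOn_image_iff_integrableOn_abs_deriv_smul measurableSet_Ioi
      (f' := fun t => -Real.exp (-t))]
  · refine integrableOn_congr_fun (fun t _ => ?_) measurableSet_Ioi
    have hpos : 0 < Real.exp (-t) := Real.exp_pos _
    simp only [abs_neg, abs_of_pos hpos, smul_eq_mul, Real.log_exp, neg_neg,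
      finrank_euclideanSpace_fin]
    have : Real.exp (-t) * Real.exp (-t) ^ (N - 1) = Real.exp (-t) ^ N := mul_pow_sub_one hN _
    rw [zpow_neg, zpow_natCast, ← mul_assoc, ← mul_assoc, this,
      mul_inv_cancel₀ (pow_ne_zero _ hpos.ne'), one_mul]
  · intro t _
    refine HasDerivAt.hasDerivWithinAt ?_
    simpa using (hasDerivAt_neg t).exp
  · intro s _ t _ h
    simpa using h

theorem integrableOn_inv_mul_log_sub_zpow (a : ℝ) :
    IntegrableOn (fun t : ℝ => t⁻¹ * (Real.log t - a) ^ (-2 : ℤ)) (Ioi (Real.exp (a + 1 / 2)))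
      volume := by
  have hd : ∀ t ∈ Ici (Real.exp (a + 1 / 2)), HasDerivAt (fun t => -(Real.log t - a)⁻¹)
      (t⁻¹ * (Real.log t - a) ^ (-2 : ℤ)) t := by
    intro t ht
    have h0 : 0 < t := (Real.exp_pos _).trans_le ht
    have h1 : Real.log t - a ≠ 0 := by
      have := (Real.le_log_iff_exp_le h0).2 ht
      linarith
    refine (((Real.hasDerivAt_log h0.ne').sub_const a).inv h1).neg.congr_deriv ?_
    rw [zpow_neg]
    norm_cast
    field_simp
  refine integrableOn_Ioi_deriv_of_nonneg (g := fun t => -(Real.log t - a)⁻¹) (l := 0)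
    (hd _ self_mem_Ici).continuousAt.continuousWithinAt
    (fun t ht => hd t (Ioi_subset_Ici_self ht)) (fun t ht => ?_) ?_
  · have h0 : 0 < t := (Real.exp_pos _).trans ht
    exact mul_nonneg (inv_nonneg.2 h0.le) (even_two.neg.zpow_nonneg _)
  · have : Tendsto (fun t => Real.log t - a) atTop atTop :=
      tendsto_atTop_add_const_right _ (-a) Real.tendsto_log_atTop
    simpa using this.inv_tendsto_atTop.neg

/-! ### Nonexistence -/

/-- The weight multiplying `u` when the inequality is tested with the Emden–Fowler transform of
`powerProfile β a χ`. -/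
noncomputable def testWeight (N : ℕ) (β : ℝ) (x : E N) : ℝ :=
  ‖x‖ ^ ((2 - (N : ℝ)) / 2) * ‖x‖ ^ (-2 : ℤ) * (-Real.log ‖x‖) ^ (β - 3 / 2)

theorem testWeight_pos {N : ℕ} {R β : ℝ} (hR1 : R ≤ 1) {x : E N} (hx : x ∈ puncturedBall N R) :
    0 < testWeight N β x := by
  have h1 := norm_pos_of_mem_puncturedBall hx
  have h2 := neg_log_pos_of_mem_puncturedBall hR1 hx
  unfold testWeight
  positivity

theorem measurable_testWeight (N : ℕ) (β : ℝ) : Measurable (testWeight N β) := by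
  unfold testWeight
  have : Measurable fun x : E N => ‖x‖ := measurable_norm
  exact ((this.pow_const _).mul (this.pow_const _)).mul
    ((Real.measurable_log.comp this).neg.pow_const _)

/-- The identity behind the test functions: the adjoint operator applied to the Emden–Fowler
transform of `powerProfile β a χ`. -/
theorem laplacian_emdenFowler_powerProfile {N : ℕ} {R β a : ℝ} (hR1 : R ≤ 1) {χ : ℝ → ℝ}
    (hχ : ContDiff ℝ ∞ χ) (h : ∀ s, s ≤ 0 → χ s = 0) {x : E N} (hx : x ∈ puncturedBall N R) :
    Laplacian.laplacian (emdenFowler N (powerProfile β a χ)) x + (((N : ℝ) - 2) ^ 2 / 4 +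
      (1 / 4 - β ^ 2) * |Real.log ‖x‖| ^ (-2 : ℤ)) * ‖x‖ ^ (-2 : ℤ) *
        emdenFowler N (powerProfile β a χ) x =
    testWeight N β x * (deriv (deriv χ) (Real.log (-Real.log ‖x‖) - a) +
      2 * β * deriv χ (Real.log (-Real.log ‖x‖) - a)) := by
  have ht := neg_log_pos_of_mem_puncturedBall hR1 hx
  have hf : ContDiff ℝ ∞ (powerProfile β a χ) := contDiff_powerProfile hχ h
  have hf' : ContDiff ℝ ∞ (deriv (powerProfile β a χ)) := (contDiff_infty_iff_deriv.1 hf).2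
  have habs : |Real.log ‖x‖| ^ (-2 : ℤ) = (-Real.log ‖x‖) ^ (-2 : ℤ) := by
    rw [abs_of_neg (by linarith)]
  rw [laplacian_emdenFowler hx.2
    (Eventually.of_forall fun t => (hf.differentiable (by simp) t).hasDerivAt)
    (hf'.differentiable (by simp) _).hasDerivAt, habs]
  have key := deriv_deriv_powerProfile (β := β) (a := a) hχ ht
  unfold emdenFowler testWeight
  rw [mul_assoc _ (_ ^ (β - 3 / 2)), ← key]
  ring

/-- The `L²` condition bounds `u` against the truncation error: the product
`u · testWeight / s`, `s = log t - a`, splits as `(u |x|⁻¹ t^(β-1)) (|x|^(-N/2) t^(-1/2) s⁻¹)` and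
both factors are square integrable on `{s ≥ 1}`. -/
theorem integrableOn_mul_testWeight_div {N : ℕ} (hN : N ≠ 0) {R β a : ℝ} {u : E N → ℝ}
    (hR1 : R ≤ 1) (ha : Real.exp (-Real.exp a) < R)
    (hu : MemWeightedL2Loc R (1 - β) u) :
    IntegrableOn (fun x => u x * (testWeight N β x / (Real.log (-Real.log ‖x‖) - a)))
      (puncturedBall N R ∩ {x | 1 ≤ Real.log (-Real.log ‖x‖) - a}) volume := by
  have hlt : Real.exp (-Real.exp (a + 1)) < Real.exp (-Real.exp (a + 1 / 2)) := by
    rw [Real.exp_lt_exp, neg_lt_neg_iff, Real.exp_lt_exp]; linarith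
  have hlt' : Real.exp (-Real.exp (a + 1)) < R := by
    refine lt_trans ?_ ha
    rw [Real.exp_lt_exp, neg_lt_neg_iff, Real.exp_lt_exp]; linarith
  have hmeas : Measurable fun x : E N => Real.log (-Real.log ‖x‖) - a := by fun_prop
  have hSm : MeasurableSet (puncturedBall N R ∩ {x | 1 ≤ Real.log (-Real.log ‖x‖) - a}) :=
    (isOpen_puncturedBall N R).measurableSet.inter (measurableSet_le measurable_const hmeas)
  set S := puncturedBall N R ∩ {x | 1 ≤ Real.log (-Real.log ‖x‖) - a} with hS
  have hsub : S ⊆ closedBall 0 (Real.exp (-Real.exp (a + 1))) := by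
    rintro x ⟨hx, hx1⟩
    have h1 := norm_pos_of_mem_puncturedBall hx
    have h2 := neg_log_pos_of_mem_puncturedBall hR1 hx
    have h3 : Real.exp (a + 1) ≤ -Real.log ‖x‖ := (Real.le_log_iff_exp_le h2).1 (by
      have : 1 ≤ Real.log (-Real.log ‖x‖) - a := hx1
      linarith)
    rw [mem_closedBall_zero_iff]
    exact (Real.log_le_iff_le_exp h1).1 (by linarith)
  obtain ⟨hm, hi⟩ := hu _ (isCompact_closedBall 0 _) (closedBall_subset_ball hlt')
  have hi1 := hi.mono_set hsub
  have hi2 := ((integrableOn_ball_iff_neg_log hN _ _).2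
    (integrableOn_inv_mul_log_sub_zpow a)).mono_set (hsub.trans (closedBall_subset_ball hlt))
  refine (hi1.add hi2).mono' ?_ ?_
  · exact (hm.mono_measure (Measure.restrict_mono hsub le_rfl)).mul
      ((measurable_testWeight N β).div hmeas).aestronglyMeasurable
  · refine (ae_restrict_iff' hSm).2 (Eventually.of_forall fun x hx => ?_)
    have hr := norm_pos_of_mem_puncturedBall hx.1
    have ht := neg_log_pos_of_mem_puncturedBall hR1 hx.1
    have hs : 0 < Real.log (-Real.log ‖x‖) - a := zero_lt_one.trans_le hx.2
    set r := ‖x‖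
    set t := -Real.log r with htdef
    set s := Real.log t - a
    have habs : |Real.log r| = t := by rw [abs_of_neg (by linarith)]
    have e1 : t ^ (-2 * (1 - β)) = (t ^ (β - 1)) ^ 2 := by
      rw [← Real.rpow_natCast, ← Real.rpow_mul ht.le]; congr 1; push_cast; ring
    have e2 : r ^ (-(N : ℤ)) = (r ^ (-(N : ℝ) / 2)) ^ 2 := by
      rw [← Real.rpow_natCast, ← Real.rpow_mul hr.le, ← Real.rpow_intCast]; congr 1; push_cast; ring
    have e3 : t⁻¹ = (t ^ (-(1 / 2) : ℝ)) ^ 2 := by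
      rw [← Real.rpow_natCast, ← Real.rpow_mul ht.le, ← Real.rpow_neg_one]; congr 1; push_cast; ring
    have e4 : s ^ (-2 : ℤ) = (s⁻¹) ^ 2 := by rw [zpow_neg, inv_pow]; norm_cast
    have e5 : r ^ (-2 : ℤ) = (r⁻¹) ^ 2 := by rw [zpow_neg, inv_pow]; norm_cast
    have e6 : testWeight N β x / s =
        (r⁻¹ * t ^ (β - 1)) * (r ^ (-(N : ℝ) / 2) * t ^ (-(1 / 2) : ℝ) * s⁻¹) := by
      have h1 : r ^ ((2 - (N : ℝ)) / 2) = r ^ (-(N : ℝ) / 2) * r := by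
        rw [← Real.rpow_add_one hr.ne']; congr 1; ring
      have h2 : t ^ (β - 3 / 2) = t ^ (β - 1) * t ^ (-(1 / 2) : ℝ) := by
        rw [← Real.rpow_add ht]; congr 1; ring
      have h3 : testWeight N β x = r ^ ((2 - (N : ℝ)) / 2) * r ^ (-2 : ℤ) * t ^ (β - 3 / 2) := rfl
      rw [h3, h1, h2, e5]
      field_simp
    change ‖u x * (testWeight N β x / s)‖ ≤ |u x| ^ 2 * (r ^ (-2 : ℤ) *
      |Real.log r| ^ (-2 * (1 - β))) + r ^ (-(N : ℤ)) * (t⁻¹ * s ^ (-2 : ℤ))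
    rw [habs, e1, e2, e3, e4, e5, e6, Real.norm_eq_abs, abs_mul,
      abs_of_pos (a := _ * _) (by positivity)]
    set A := r⁻¹ * t ^ (β - 1)
    set B := r ^ (-(N : ℝ) / 2) * t ^ (-(1 / 2) : ℝ) * s⁻¹
    have hA : |u x| ^ 2 * (r⁻¹ ^ 2 * (t ^ (β - 1)) ^ 2) = (|u x| * A) ^ 2 := by
      simp only [A]; ring
    have hB : (r ^ (-(N : ℝ) / 2)) ^ 2 * ((t ^ (-(1 / 2) : ℝ)) ^ 2 * s⁻¹ ^ 2) = B ^ 2 := by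
      simp only [B]; ring
    rw [hA, hB]
    nlinarith [sq_nonneg (|u x| * A - B), sq_nonneg (|u x| * A), sq_nonneg B]

/-- A nonnegative supersolution vanishes where `-log|x| > e^a`: testing with the truncated
subsolutions `χₙ(log t - a)`, the truncation errors live on `{log t - a ≥ n}` and tend to zero by
the `L²` condition. -/
theorem IsSupersolution.ae_eq_zero_of_exp_lt {N : ℕ} (hN : N ≠ 0) {R α β a : ℝ} {u : E N → ℝ}
    (hR1 : R ≤ 1) (ha : Real.exp (-Real.exp a) < R) (hβ : 0 ≤ β) (hα : 1 / 4 - β ^ 2 ≤ α)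
    (hu0 : ∀ᵐ x ∂(volume.restrict (puncturedBall N R)), 0 ≤ u x)
    (hu : IsSupersolution R α u) (hu2 : MemWeightedL2Loc R (1 - β) u) :
    ∀ᵐ x ∂(volume.restrict (puncturedBall N R)), 0 < Real.log (-Real.log ‖x‖) - a → u x = 0 := by
  obtain ⟨C, ρ, χ, hρ, hχ⟩ := exists_truncated_subsolution hβ
  have hΩm : MeasurableSet (puncturedBall N R) := (isOpen_puncturedBall N R).measurableSet
  set Ω := puncturedBall N R with hΩ
  set σ : E N → ℝ := fun x => Real.log (-Real.log ‖x‖) - a with hσ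
  have hσm : Measurable σ := by fun_prop
  set w := testWeight N β with hw
  have hmem : ∀ᵐ x ∂(volume.restrict Ω), x ∈ Ω := ae_restrict_mem hΩm
  set F : ℕ → E N → ℝ := fun n x => u x * (w x *
    (deriv (deriv (χ n)) (σ x) + 2 * β * deriv (χ n) (σ x))) with hF
  have hFn : ∀ n, 1 ≤ n → IntegrableOn (F n) Ω volume ∧ ∫ x in Ω, F n x ≤ 0 := by
    intro n hn
    obtain ⟨hs, hp⟩ := hχ n hn
    have h0 : ∀ s, s ≤ 0 → χ n s = 0 := fun s => (hp s).2.1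
    have htest : IsTestFunction Ω (emdenFowler N (powerProfile β a (χ n))) :=
      isTestFunction_emdenFowler (contDiff_powerProfile hs h0)
        (fun t ht => powerProfile_of_le h0 ht)
        (fun t ht => powerProfile_of_ge (fun s => (hp s).2.2.1) ht) (Real.exp_pos a) ha
    have hnn : ∀ x, 0 ≤ emdenFowler N (powerProfile β a (χ n)) x := fun x =>
      mul_nonneg (Real.rpow_nonneg (norm_nonneg _) _) (powerProfile_nonneg (fun s => (hp s).1) _)
    obtain ⟨hi, hle⟩ := hu.setIntegral_nonpos hR1 hα hu0 htest hnn
    have hcongr : ∀ x ∈ Ω, _ = F n x := fun x hx =>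
      congrArg (u x * ·) (laplacian_emdenFowler_powerProfile hR1 hs h0 hx)
    exact ⟨hi.congr_fun hcongr hΩm, (setIntegral_congr_fun hΩm hcongr).symm.trans_le hle⟩
  -- the tail of the truncation error
  set H : E N → ℝ := fun x => u x * (w x / σ x) with hH
  set T : ℕ → Set (E N) := fun n => Ω ∩ {x | (n : ℝ) ≤ σ x} with hT
  have hTm : ∀ n, MeasurableSet (T n) := fun n =>
    hΩm.inter (measurableSet_le measurable_const hσm)
  have hTanti : Antitone T := fun m n hmn x hx =>
    ⟨hx.1, show (m : ℝ) ≤ σ x from (Nat.cast_le.2 hmn).trans hx.2⟩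
  have hHi : IntegrableOn H (T 1) volume := by
    have := integrableOn_mul_testWeight_div hN hR1 ha hu2
    simpa [hT, hH, hw, hσ] using this
  have htail : Tendsto (fun n => ∫ x in T n, H x) atTop (𝓝 0) := by
    have h := tendsto_setIntegral_of_antitone hTm hTanti ⟨1, hHi⟩
    have hempty : ⋂ n, T n = ∅ := by
      refine eq_empty_of_forall_notMem fun x hx => ?_
      obtain ⟨n, hn⟩ := exists_nat_gt (σ x)
      exact (mem_iInter.1 hx n).2.not_gt hn
    simpa [hempty] using h
  -- the limiting inequality on `{0 < σ < m}`
  have hD : ∀ m : ℕ, 1 ≤ m → ∀ᵐ x ∂(volume.restrict Ω), 0 < σ x → σ x < m → u x = 0 := by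
    intro m hm
    set D : Set (E N) := {x | 0 < σ x} ∩ {x | σ x < m} with hDdef
    have hDm : MeasurableSet D :=
      (measurableSet_lt measurable_const hσm).inter (measurableSet_lt hσm measurable_const)
    set G : E N → ℝ := D.indicator fun x => u x * (w x * ρ (σ x)) with hG
    have hGF : G = D.indicator (F m) := by
      refine indicator_congr fun x hx => ?_
      simp only [hF]
      rw [((hχ m hm).2 (σ x)).2.2.2.1 hx.1 hx.2]
    have hGi : IntegrableOn G Ω volume := by
      rw [hGF]; exact (hFn m hm).1.indicator hDm
    have hG0 : 0 ≤ᵐ[volume.restrict Ω] G := by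
      filter_upwards [hu0, hmem] with x hx hxΩ
      by_cases hxD : x ∈ D
      · rw [hG, indicator_of_mem hxD]
        exact mul_nonneg hx (mul_nonneg (testWeight_pos hR1 hxΩ).le (hρ _ hxD.1).le)
      · rw [hG, indicator_of_notMem hxD]; rfl
    have hle : ∀ n, m ≤ n → ∫ x in Ω, G x ≤ C * ∫ x in T n, H x := by
      intro n hn
      have hn1 : 1 ≤ n := hm.trans hn
      have hTi : IntegrableOn ((T n).indicator fun x => C * H x) Ω volume :=
        ((integrable_indicator_iff (hTm n)).2
          ((hHi.mono_set (hTanti hn1)).const_mul C)).integrableOn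
      have hpt : ∀ᵐ x ∂(volume.restrict Ω),
          G x - (T n).indicator (fun x => C * H x) x ≤ F n x := by
        filter_upwards [hu0, hmem] with x hx hxΩ
        have hwx : 0 < w x := testWeight_pos hR1 hxΩ
        have hp := (hχ n hn1).2 (σ x)
        rcases lt_or_ge (σ x) n with h | h
        · have hnT : x ∉ T n := fun hxT => hxT.2.not_gt h
          rw [indicator_of_notMem hnT, sub_zero]
          by_cases hxD : x ∈ D
          · simp only [hG, indicator_of_mem hxD, hF]
            rw [hp.2.2.2.1 hxD.1 h]
          · simp only [hG, indicator_of_notMem hxD, hF]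
            exact mul_nonneg hx (mul_nonneg hwx.le (hp.2.2.2.2.1 h))
        · have hxT : x ∈ T n := ⟨hxΩ, h⟩
          have hxD : x ∉ D := fun hxD => (hxD.2.trans_le (Nat.cast_le.2 hn)).not_ge h
          rw [indicator_of_mem hxT]
          simp only [hG, indicator_of_notMem hxD, hF, hH]
          have := mul_le_mul_of_nonneg_left (hp.2.2.2.2.2 h) (mul_nonneg hx hwx.le)
          calc 0 - C * (u x * (w x / σ x)) = u x * w x * -(C / σ x) := by ring
            _ ≤ _ := this
            _ = _ := by ring
      have h1 := integral_mono_ae (hGi.sub hTi) (hFn n hn1).1 hpt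
      have h2 : ∫ x in Ω, (G - (T n).indicator fun x => C * H x) x =
          (∫ x in Ω, G x) - C * ∫ x in T n, H x := by
        rw [integral_sub' hGi hTi, setIntegral_indicator (hTm n), integral_const_mul,
          inter_eq_self_of_subset_right inter_subset_left]
      rw [h2] at h1
      linarith [(hFn n hn1).2]
    have hlim : ∫ x in Ω, G x ≤ 0 := by
      have := htail.const_mul C
      rw [mul_zero] at this
      exact ge_of_tendsto this (eventually_atTop.2 ⟨m, hle⟩)
    have hzero : G =ᵐ[volume.restrict Ω] 0 :=
      (integral_eq_zero_iff_of_nonneg_ae hG0 hGi).1 (le_antisymm hlim (integral_nonneg_of_ae hG0))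
    filter_upwards [hzero, hmem] with x hx hxΩ h1 h2
    have hwx : 0 < w x := testWeight_pos hR1 hxΩ
    have hxD : x ∈ D := ⟨h1, h2⟩
    simp only [hG, indicator_of_mem hxD, Pi.zero_apply] at hx
    exact (mul_eq_zero.1 hx).resolve_right (mul_pos hwx (hρ _ h1)).ne'
  have hall : ∀ᵐ x ∂(volume.restrict Ω), ∀ m : ℕ, 1 ≤ m → 0 < σ x → σ x < m → u x = 0 := by
    rw [ae_all_iff]
    intro m
    by_cases hm : 1 ≤ m
    · filter_upwards [hD m hm] with x hx _ using hx
    · exact Eventually.of_forall fun x h => absurd h hm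
  filter_upwards [hall] with x hx h0
  obtain ⟨n, hn⟩ := exists_nat_gt (σ x)
  refine hx n ?_ h0 hn
  by_contra h
  have : n = 0 := by omega
  subst this
  simp at hn
  linarith

theorem IsSupersolution.ae_eq_zero {N : ℕ} (hN : N ≠ 0) {R α γ : ℝ} {u : E N → ℝ} (hR0 : 0 < R)
    (hR1 : R ≤ 1) (hu0 : ∀ᵐ x ∂(volume.restrict (ball (0 : E N) R)), 0 ≤ u x)
    (hu : IsSupersolution R α u) (hγ : γ ≤ 1) (hu2 : MemWeightedL2Loc R γ u)
    (hα : 1 / 4 - (1 - γ) ^ 2 ≤ α) :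
    ∀ᵐ x ∂(volume.restrict (ball (0 : E N) R)), u x = 0 := by
  have : Nonempty (Fin N) := ⟨⟨0, Nat.pos_of_ne_zero hN⟩⟩
  have hu0' : ∀ᵐ x ∂(volume.restrict (puncturedBall N R)), 0 ≤ u x :=
    ae_restrict_of_ae_restrict_of_subset sdiff_subset hu0
  have hT0 : 0 ≤ -Real.log R := neg_nonneg.2 (Real.log_nonpos hR0.le hR1)
  -- the half-lines `t > -log R + 1/(k+1)` exhaust `t > -log R`, which is the punctured ball
  have hpos : ∀ k : ℕ, 0 < -Real.log R + 1 / ((k : ℝ) + 1) := fun k => by positivity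
  have hk : ∀ k : ℕ, ∀ᵐ x ∂(volume.restrict (puncturedBall N R)),
      0 < Real.log (-Real.log ‖x‖) - Real.log (-Real.log R + 1 / ((k : ℝ) + 1)) → u x = 0 := by
    intro k
    refine hu.ae_eq_zero_of_exp_lt (β := 1 - γ) hN hR1 ?_ (by linarith) hα hu0' (by simpa using hu2)
    rw [Real.exp_log (hpos k), ← Real.lt_log_iff_exp_lt hR0]
    have : 0 < 1 / ((k : ℝ) + 1) := by positivity
    linarith
  have hbase : ∀ᵐ x ∂(volume.restrict (puncturedBall N R)), u x = 0 := by
    filter_upwards [ae_all_iff.2 hk,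
      ae_restrict_mem (isOpen_puncturedBall N R).measurableSet] with x hx hxΩ
    have hlog : Real.log ‖x‖ < Real.log R :=
      Real.log_lt_log (norm_pos_of_mem_puncturedBall hxΩ) (mem_ball_zero_iff.1 hxΩ.1)
    obtain ⟨k, hk⟩ := exists_nat_one_div_lt (sub_pos.2 hlog)
    refine hx k (sub_pos.2 (Real.log_lt_log (hpos k) ?_))
    linarith
  have hae : puncturedBall N R =ᵐ[volume] ball (0 : E N) R :=
    sdiff_null_ae_eq_self (measure_singleton 0)
  rwa [Measure.restrict_congr_set hae] at hbase

/-! ### The explicit solutions -/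

theorem explicitSolution_eq_emdenFowler (N : ℕ) (α : ℝ) : explicitSolution N α =
    emdenFowler N fun t => |t| ^ (-((Real.sqrt (1 - 4 * α) - 1) / 2)) := by
  ext x
  simp [explicitSolution, emdenFowler]

theorem explicitSolution_pos {N : ℕ} {R α : ℝ} (hR1 : R ≤ 1) {x : E N}
    (hx : x ∈ puncturedBall N R) : 0 < explicitSolution N α x := by
  have h1 := norm_pos_of_mem_puncturedBall hx
  have h2 : 0 < |Real.log ‖x‖| := by
    have := neg_log_pos_of_mem_puncturedBall hR1 hx
    exact abs_pos.2 (by linarith)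
  unfold explicitSolution
  positivity

theorem contDiffAt_explicitSolution {N : ℕ} {R α : ℝ} (hR1 : R ≤ 1) {x : E N}
    (hx : x ∈ puncturedBall N R) : ContDiffAt ℝ ∞ (explicitSolution N α) x := by
  have ht := neg_log_pos_of_mem_puncturedBall hR1 hx
  rw [explicitSolution_eq_emdenFowler]
  exact contDiffAt_emdenFowler hx.2
    ((contDiffAt_abs ht.ne').rpow_const_of_ne (abs_ne_zero.2 ht.ne'))

/-- `f(t) = t^(-δ)` solves `f'' + α t⁻² f = 0`, as `δ(δ + 1) = -α`. -/
theorem laplacian_explicitSolution {N : ℕ} {R α : ℝ} (hR1 : R ≤ 1) (hα : α ≤ 1 / 4) {x : E N}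
    (hx : x ∈ puncturedBall N R) :
    Laplacian.laplacian (explicitSolution N α) x = -(((N : ℝ) - 2) ^ 2 / 4 +
      α * |Real.log ‖x‖| ^ (-2 : ℤ)) * ‖x‖ ^ (-2 : ℤ) * explicitSolution N α x := by
  have ht := neg_log_pos_of_mem_puncturedBall hR1 hx
  set p : ℝ := -((Real.sqrt (1 - 4 * α) - 1) / 2) with hp
  have hpα : p * (p - 1) = -α := by
    have := Real.sq_sqrt (by linarith : 0 ≤ 1 - 4 * α)
    rw [hp]; nlinarith
  have hd : ∀ (q z : ℝ), 0 < z → HasDerivAt (fun z : ℝ => z ^ q) (q * z ^ (q - 1)) z :=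
    fun q z hz => Real.hasDerivAt_rpow_const (Or.inl hz.ne')
  rw [explicitSolution_eq_emdenFowler, laplacian_emdenFowler
    (f' := fun t => p * t ^ (p - 1)) hx.2 ?_ ((hd (p - 1) _ ht).const_mul p)]
  · have e1 : (-Real.log ‖x‖) ^ (p - 1 - 1) =
        (-Real.log ‖x‖) ^ p * (-Real.log ‖x‖) ^ (-2 : ℤ) := by
      rw [← Real.rpow_intCast, ← Real.rpow_add ht]; congr 1; push_cast; ring
    have habs : |Real.log ‖x‖| = -Real.log ‖x‖ := abs_of_neg (by linarith)
    simp only [emdenFowler, abs_of_pos ht, habs]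
    rw [e1, ← hp]
    linear_combination (‖x‖ ^ ((2 - (N : ℝ)) / 2) * ‖x‖ ^ (-2 : ℤ) * (-Real.log ‖x‖) ^ p *
      (-Real.log ‖x‖) ^ (-2 : ℤ)) * hpα
  · filter_upwards [lt_mem_nhds ht] with z hz
    refine (hd p z hz).congr_of_eventuallyEq ?_
    filter_upwards [lt_mem_nhds hz] with y hy
    rw [abs_of_pos hy]

theorem isSolution_explicitSolution {N : ℕ} {R α : ℝ} (hR1 : R ≤ 1) (hα : α ≤ 1 / 4) :
    IsSolution R α (explicitSolution N α) := by
  have hΩ := isOpen_puncturedBall N R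
  have hcont : ContinuousOn (explicitSolution N α) (puncturedBall N R) := fun x hx =>
    (contDiffAt_explicitSolution hR1 hx).continuousAt.continuousWithinAt
  have hloc : LocallyIntegrableOn (explicitSolution N α) (puncturedBall N R) volume :=
    hcont.locallyIntegrableOn hΩ.measurableSet
  refine ⟨hloc, fun φ hφ => ?_⟩
  have hv : ∀ x, x ∉ tsupport φ → φ x = 0 := fun x hx => image_eq_zero_of_notMem_tsupport hx
  have i2 := integrableOn_mul_of_tsupport hΩ hloc hφ (ψ := fun x => ‖x‖ ^ (-2 : ℤ) * φ x)
    ((continuousOn_norm_zpow_puncturedBall N R).mul hφ.contDiff.continuous.continuousOn)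
    (fun x hx => by rw [hv x hx, mul_zero])
  have i3 := integrableOn_mul_of_tsupport hΩ hloc hφ
    (ψ := fun x => ‖x‖ ^ (-2 : ℤ) * |Real.log ‖x‖| ^ (-2 : ℤ) * φ x)
    (((continuousOn_norm_zpow_puncturedBall N R).mul
      (continuousOn_abs_log_zpow_puncturedBall N hR1)).mul hφ.contDiff.continuous.continuousOn)
    (fun x hx => by rw [hv x hx, mul_zero])
  rw [hardyPairing, lerayPairing,
    setIntegral_mul_laplacian hΩ (fun x hx => contDiffAt_explicitSolution hR1 hx) hφ]
  have e1 : ∫ x in puncturedBall N R, Laplacian.laplacian (explicitSolution N α) x * φ x =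
      ∫ x in puncturedBall N R,
        (-(((N : ℝ) - 2) ^ 2 / 4) * (explicitSolution N α x * (‖x‖ ^ (-2 : ℤ) * φ x)) + -α *
        (explicitSolution N α x * (‖x‖ ^ (-2 : ℤ) * |Real.log ‖x‖| ^ (-2 : ℤ) * φ x))) := by
    refine setIntegral_congr_fun hΩ.measurableSet fun x hx => ?_
    simp only [laplacian_explicitSolution hR1 hα hx]
    ring
  have e2 : ∫ x in puncturedBall N R, ‖x‖ ^ (-2 : ℤ) * explicitSolution N α x * φ x =
      ∫ x in puncturedBall N R, explicitSolution N α x * (‖x‖ ^ (-2 : ℤ) * φ x) := by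
    congr 1; ext x; ring
  have e3 : ∫ x in puncturedBall N R,
      ‖x‖ ^ (-2 : ℤ) * |Real.log ‖x‖| ^ (-2 : ℤ) * explicitSolution N α x * φ x =
      ∫ x in puncturedBall N R,
        explicitSolution N α x * (‖x‖ ^ (-2 : ℤ) * |Real.log ‖x‖| ^ (-2 : ℤ) * φ x) := by
    congr 1; ext x; ring
  rw [e1, e2, e3, integral_add (i2.const_mul _) (i3.const_mul _), integral_const_mul,
    integral_const_mul]
  ring

/-- In the variable `t = -log|x|` the weighted `L²` norm of the explicit solution is the integral
of the power `t^(-2δ-2γ)`. -/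
theorem integrableOn_explicitSolution_sq_iff {N : ℕ} (hN : N ≠ 0) (α γ : ℝ) {T : ℝ} (hT : 0 < T) :
    IntegrableOn (fun x : E N => |explicitSolution N α x| ^ 2 *
      (‖x‖ ^ (-2 : ℤ) * |Real.log ‖x‖| ^ (-2 * γ))) (ball 0 (Real.exp (-T))) volume ↔
      2 * (1 - γ) < Real.sqrt (1 - 4 * α) := by
  set p : ℝ := -((Real.sqrt (1 - 4 * α) - 1) / 2) with hp
  -- at the origin both sides vanish, since `0 ^ (-2) = 0` and `0 ^ (-N) = 0`
  have hcongr : ∀ x ∈ ball (0 : E N) (Real.exp (-T)), |explicitSolution N α x| ^ 2 *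
      (‖x‖ ^ (-2 : ℤ) * |Real.log ‖x‖| ^ (-2 * γ)) =
      ‖x‖ ^ (-N : ℤ) * (fun t : ℝ => t ^ (2 * p - 2 * γ)) (-Real.log ‖x‖) := by
    intro x hx
    rcases eq_or_ne x 0 with rfl | hx0
    · simp [hN]
    have hr : 0 < ‖x‖ := norm_pos_iff.2 hx0
    have ht : 0 < -Real.log ‖x‖ := by
      have := (Real.log_lt_iff_lt_exp hr).2 (mem_ball_zero_iff.1 hx)
      linarith
    have habs : |Real.log ‖x‖| = -Real.log ‖x‖ := abs_of_neg (by linarith)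
    have e1 : (‖x‖ ^ ((2 - (N : ℝ)) / 2)) ^ 2 * ‖x‖ ^ (-2 : ℤ) = ‖x‖ ^ (-N : ℤ) := by
      rw [← Real.rpow_natCast, ← Real.rpow_mul hr.le, ← Real.rpow_intCast, ← Real.rpow_intCast,
        ← Real.rpow_add hr]
      congr 1; push_cast; ring
    have e2 : ((-Real.log ‖x‖) ^ p) ^ 2 * (-Real.log ‖x‖) ^ (-2 * γ) =
        (-Real.log ‖x‖) ^ (2 * p - 2 * γ) := by
      rw [← Real.rpow_natCast, ← Real.rpow_mul ht.le, ← Real.rpow_add ht]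
      congr 1; push_cast; ring
    simp only [explicitSolution, sq_abs, habs]
    rw [← e1, ← e2]
    ring
  refine (integrableOn_congr_fun hcongr measurableSet_ball).trans
    ((integrableOn_ball_iff_neg_log hN (fun t => t ^ (2 * p - 2 * γ)) T).trans ?_)
  rw [integrableOn_Ioi_rpow_iff hT, hp]
  constructor <;> intro h <;> linarith

/-- The condition `γ ≤ 1` makes `2(1-γ) < √(1-4α)` equivalent to its square. -/
theorem memWeightedL2Loc_explicitSolution_iff {N : ℕ} (hN : N ≠ 0) {R α γ : ℝ} (hR0 : 0 < R)
    (hR1 : R ≤ 1) (hγ : γ ≤ 1) :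
    MemWeightedL2Loc R γ (explicitSolution N α) ↔ α < 1 / 4 - (1 - γ) ^ 2 := by
  have hball : ∀ r, 0 < r → r < R → (IntegrableOn (fun x : E N => |explicitSolution N α x| ^ 2 *
      (‖x‖ ^ (-2 : ℤ) * |Real.log ‖x‖| ^ (-2 * γ))) (ball 0 r) volume ↔
      α < 1 / 4 - (1 - γ) ^ 2) := by
    intro r hr hrR
    have hT : 0 < -Real.log r := neg_pos.2 (Real.log_neg hr (hrR.trans_le hR1))
    have h := integrableOn_explicitSolution_sq_iff hN α γ hT
    rw [neg_neg, Real.exp_log hr] at h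
    rw [h, Real.lt_sqrt (by linarith)]
    constructor <;> intro h <;> linarith
  constructor
  · intro h
    have hlt : R / 2 < R := by linarith
    exact (hball (R / 2) (by positivity) hlt).1
      ((h _ (isCompact_closedBall 0 (R / 2)) (closedBall_subset_ball hlt)).2.mono_set
        ball_subset_closedBall)
  · intro h K hK hKR
    obtain ⟨r, ⟨hr0, hrR⟩, hr⟩ := exists_pos_lt_subset_ball hR0 hK.isClosed hKR
    refine ⟨?_, ((hball r hr0 hrR).2 h).mono_set hr⟩
    have : Measurable (explicitSolution N α) := by
      unfold explicitSolution
      fun_prop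
    exact this.aestronglyMeasurable

end HardyLeray

theorem mainTheorem1 (N : ℕ) (hN : 2 ≤ N) (R : ℝ) (hR0 : 0 < R) (hR1 : R ≤ 1) :
    -- nonexistence
    (∀ (α γ : ℝ) (u : HardyLeray.E N → ℝ),
      (∀ᵐ x ∂(volume.restrict (ball (0 : HardyLeray.E N) R)), 0 ≤ u x) →
      HardyLeray.IsSupersolution R α u →
      γ ≤ 1 →
      HardyLeray.MemWeightedL2Loc R γ u →
      1 / 4 - (1 - γ) ^ 2 ≤ α →
      ∀ᵐ x ∂(volume.restrict (ball (0 : HardyLeray.E N) R)), u x = 0) ∧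
    -- sharpness
    (∀ α : ℝ, α ≤ 1 / 4 →
      (∀ x ∈ HardyLeray.puncturedBall N R, 0 < HardyLeray.explicitSolution N α x) ∧
      HardyLeray.IsSolution R α (HardyLeray.explicitSolution N α) ∧
      (∀ γ : ℝ, γ ≤ 1 →
        (HardyLeray.MemWeightedL2Loc R γ (HardyLeray.explicitSolution N α) ↔
          α < 1 / 4 - (1 - γ) ^ 2))) := by
  have hN0 : N ≠ 0 := by omega
  refine ⟨fun α γ u hu0 hu hγ hu2 hα => hu.ae_eq_zero hN0 hR0 hR1 hu0 hγ hu2 hα, fun α hα => ?_⟩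
  exact ⟨fun x hx => HardyLeray.explicitSolution_pos hR1 hx,
    HardyLeray.isSolution_explicitSolution hR1 hα,
    fun γ hγ => HardyLeray.memWeightedL2Loc_explicitSolution_iff hN0 hR0 hR1 hγ⟩
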